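/- Let $k$ be a field. Algebras are associative unital $k$-algebras; for an algebra $A$ let $A^e=A\otimes_k A^{\mathrm{op}}$, so that $A$-bimodules are left $A^e$-modules. For an $A$-bimodule $M$ put $H^p(A,M)=\operatorname{Ext}^p_{A^e}(A,M)$ and $HH^p(A)=H^p(A,A)$; the Yoneda product makes $HH^*(A)=\bigoplus_{p\ge 0}HH^p(A)$ a graded $k$-algebra. A morphism of algebras $\varphi:A\to B$ is a homological epimorphism if the functor $D^b(B\text{-}\mathrm{Mod})\to D^b(A\text{-}\mathrm{Mod})$ on bounded derived categories induced by restriction of scalars along $\varphi$ is full and faithful. Let $\varphi:A\to B$ be a surjective morphism of $k$-algebras which is a homological epimorphism, and let $I=\ker\varphi$. For every $p\ge 0$ the natural $k$-linear map $c_p:HH^p(B)=\operatorname{Ext}^p_{B^e}(B,B)\to\operatorname{Ext}^p_{A^e}(B,B)\to H^p(A,B)$, given by restriction of scalars followed by composition with $\varphi:A\to B$, is bijective, and there is a long exact sequence of $k$-vector spaces $$0\to \operatorname{Ext}^0_{A^e}(A,I)\to HH^0(A)\to HH^0(B)\to \operatorname{Ext}^1_{A^e}(A,I)\to\cdots\to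 \operatorname{Ext}^p_{A^e}(A,I)\to HH^p(A)\to HH^p(B)\to \operatorname{Ext}^{p+1}_{A^e}(A,I)\to\cdots.$$ It is the long exact sequence of $\operatorname{Ext}^*_{A^e}(A,-)$ for the short exact sequence of $A$-bimodules $0\to I\to A\to B\to 0$, with $H^p(A,B)$ replaced by $HH^p(B)$ through $c_p$. The maps $HH^p(A)\to HH^p(B)$ in this sequence are the homogeneous components of a morphism of $k$-algebras $HH^*(A)\to HH^*(B)$. -/

import Mathlib

open CategoryTheory CategoryTheory.Abelian
open scoped TensorProduct DirectSum ModuleCat.Algebra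

universe u v

noncomputable section

namespace Hochschild

/-! ### Homological epimorphisms -/

section Derived

universe w₁ w₂ v₁ v₂ u₁ u₂

variable {C : Type u₁} [Category.{v₁} C] [Abelian C] [HasDerivedCategory.{w₁} C]
  {D : Type u₂} [Category.{v₂} D] [Abelian D] [HasDerivedCategory.{w₂} D]
  (F : C ⥤ D) [F.Additive] [Limits.PreservesFiniteLimits F] [Limits.PreservesFiniteColimits F]

/-- The functor induced on derived categories by an exact functor preserves boundedness. -/
theorem bounded_mapDerivedCategory (X : DerivedCategory.Bounded C) :
    (DerivedCategory.TStructure.t : Triangulated.TStructure (DerivedCategory D)).bounded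
      ((DerivedCategory.Bounded.ι ⋙ F.mapDerivedCategory).obj X) := by
  obtain ⟨X, ⟨a, ha⟩, ⟨b, hb⟩⟩ := X
  constructor
  · obtain ⟨K, hK, ⟨e⟩⟩ := DerivedCategory.exists_iso_Q_obj_of_isGE X a
    refine ⟨a, ⟨(F.mapHomologicalComplex (.up ℤ)).obj K,
      F.mapDerivedCategory.mapIso e ≪≫ F.mapDerivedCategoryFactors.app K, ?_⟩⟩
    infer_instance
  · obtain ⟨K, hK, ⟨e⟩⟩ := DerivedCategory.exists_iso_Q_obj_of_isLE X b
    refine ⟨b, ⟨(F.mapHomologicalComplex (.up ℤ)).obj K,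
      F.mapDerivedCategory.mapIso e ≪≫ F.mapDerivedCategoryFactors.app K, ?_⟩⟩
    infer_instance

/-- The functor `D^b(C) ⥤ D^b(D)` induced by an exact functor `C ⥤ D`. -/
def mapBoundedDerivedCategory : DerivedCategory.Bounded C ⥤ DerivedCategory.Bounded D :=
  ObjectProperty.lift _ (DerivedCategory.Bounded.ι ⋙ F.mapDerivedCategory)
    (bounded_mapDerivedCategory F)

end Derived

section Restriction

variable {A B : Type v} [Ring A] [Ring B] (φ : A →+* B)

theorem restrictScalars_map_exact (S : ShortComplex (ModuleCat.{v} B)) (h : S.Exact) :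
    (S.map (ModuleCat.restrictScalars.{v} φ)).Exact := by
  rw [ShortComplex.ShortExact.moduleCat_exact_iff_function_exact] at h ⊢
  exact h

instance preservesFiniteLimits_restrictScalars :
    Limits.PreservesFiniteLimits (ModuleCat.restrictScalars.{v} φ) := by
  have := ((Functor.exact_tfae (ModuleCat.restrictScalars.{v} φ)).out 1 3).mp
    (restrictScalars_map_exact φ)
  exact this.1

instance preservesFiniteColimits_restrictScalars :
    Limits.PreservesFiniteColimits (ModuleCat.restrictScalars.{v} φ) := by
  have := ((Functor.exact_tfae (ModuleCat.restrictScalars.{v} φ)).out 1 3).mp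
    (restrictScalars_map_exact φ)
  exact this.2

end Restriction

/-- A ring morphism `φ : A → B` is a homological epimorphism if the functor
`D^b(B-Mod) ⥤ D^b(A-Mod)` induced by restriction of scalars along `φ` is full and faithful. -/
def IsHomologicalEpi {A B : Type v} [Ring A] [Ring B] (φ : A →+* B) : Prop :=
  letI := HasDerivedCategory.standard (ModuleCat.{v} A)
  letI := HasDerivedCategory.standard (ModuleCat.{v} B)
  (mapBoundedDerivedCategory (ModuleCat.restrictScalars.{v} φ)).Full ∧
    (mapBoundedDerivedCategory (ModuleCat.restrictScalars.{v} φ)).Faithful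

/-! ### Bimodules over the enveloping algebra -/

section Bimodules

variable (k : Type u) [Field k] (A : Type v) [Ring A] [Algebra k A]

/-- The enveloping algebra `A^e = A ⊗ A^op`. -/
abbrev Env : Type v := A ⊗[k] Aᵐᵒᵖ

/-- The regular bimodule `A`, as a left module over `A^e`: `(a ⊗ b) • m = a * m * b`. -/
def regularBimodule : ModuleCat.{v} (Env k A) :=
  letI : Module (Env k A) A := TensorProduct.Algebra.module
  ModuleCat.of (Env k A) A

variable {k A} {B : Type v} [Ring B] [Algebra k B] (φ : A →ₐ[k] B)

/-- The algebra morphism `φ^e = φ ⊗ φ^op : A^e → B^e`. -/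
def envMap : Env k A →ₐ[k] Env k B :=
  Algebra.TensorProduct.map φ φ.op

/-- Restriction of scalars from `B`-bimodules to `A`-bimodules. -/
abbrev restrictBimodule : ModuleCat.{v} (Env k B) ⥤ ModuleCat.{v} (Env k A) :=
  ModuleCat.restrictScalars.{v} (envMap φ).toRingHom

/-- The regular bimodule `B`, seen as an `A`-bimodule along `φ`. -/
abbrev targetBimodule : ModuleCat.{v} (Env k A) :=
  (restrictBimodule φ).obj (regularBimodule k B)

theorem bimoduleMap_smul (x : Env k A) (m : A) :
    φ (TensorProduct.Algebra.moduleAux x m) =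
      TensorProduct.Algebra.moduleAux (envMap φ x) (φ m) := by
  induction x using TensorProduct.induction_on with
  | zero => simp
  | tmul a b =>
    simp [envMap, TensorProduct.Algebra.moduleAux_apply]
  | add x y hx hy => simp only [map_add, LinearMap.add_apply, hx, hy]

/-- `φ` as a morphism of `A`-bimodules `A ⟶ B`. -/
def bimoduleMap : regularBimodule k A ⟶ targetBimodule φ :=
  ModuleCat.ofHom (X := regularBimodule k A) (Y := targetBimodule φ)
    { toFun := fun a => φ a
      map_add' := fun a b => map_add φ a b
      map_smul' := fun x m => bimoduleMap_smul φ x m }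

/-- The kernel `I = ker φ`, as an `A`-bimodule. -/
def kerBimodule : ModuleCat.{v} (Env k A) :=
  ModuleCat.of (Env k A) (LinearMap.ker (bimoduleMap φ).hom)

/-- The inclusion `I ⟶ A`. -/
def kerInclusion : kerBimodule φ ⟶ regularBimodule k A :=
  ModuleCat.ofHom (X := LinearMap.ker (bimoduleMap φ).hom) (Y := regularBimodule k A)
    (LinearMap.ker (bimoduleMap φ).hom).subtype

/-- The sequence of `A`-bimodules `I ⟶ A ⟶ B`. -/
abbrev kerSequence : ShortComplex (ModuleCat.{v} (Env k A)) :=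
  ShortComplex.mk (kerInclusion φ) (bimoduleMap φ)
    (ModuleCat.hom_ext (LinearMap.ext fun x => x.2))

/-- If `φ` is surjective then `0 ⟶ I ⟶ A ⟶ B ⟶ 0` is a short exact sequence of `A`-bimodules. -/
theorem kerSequence_shortExact (hφ : Function.Surjective φ) : (kerSequence φ).ShortExact where
  exact := by
    rw [ShortComplex.ShortExact.moduleCat_exact_iff_function_exact]
    exact fun y => ⟨fun hy => ⟨⟨y, hy⟩, rfl⟩, fun ⟨x, hx⟩ => hx ▸ x.2⟩
  mono_f := (ModuleCat.mono_iff_injective (kerInclusion φ)).2 Subtype.val_injective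
  epi_g := (ModuleCat.epi_iff_surjective (bimoduleMap φ)).2 hφ

end Bimodules

/-! ### Hochschild cohomology and its Yoneda product -/

section Cohomology

variable (k : Type u) [Field k] (A : Type v) [Ring A] [Algebra k A]

/-- Hochschild cohomology `H^p(A, M) = Ext_{A^e}^p(A, M)`. -/
abbrev HochschildCohomology (M : ModuleCat.{v} (Env k A)) (p : ℕ) : Type v :=
  Ext.{v} (regularBimodule k A) M p

/-- `HH^p(A) = H^p(A, A)`. -/
def HH (p : ℕ) : Type v := HochschildCohomology k A (regularBimodule k A) p

instance (p : ℕ) : AddCommGroup (HH k A p) :=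
  inferInstanceAs (AddCommGroup (HochschildCohomology k A (regularBimodule k A) p))

instance (p : ℕ) : Module k (HH k A p) :=
  inferInstanceAs (Module k (HochschildCohomology k A (regularBimodule k A) p))

variable {k A}

/-- The identity of `A`, as a class in `HH^0(A)`. -/
def HH.one : HH k A 0 := Ext.mk₀ (𝟙 (regularBimodule k A))

/-- The Yoneda product `α ∘ β` of classes in `HH^p(A)` and `HH^q(A)`. -/
def HH.mul {p q : ℕ} (α : HH k A p) (β : HH k A q) : HH k A (p + q) :=
  Ext.comp (X := regularBimodule k A) (Y := regularBimodule k A) (Z := regularBimodule k A)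
    β α (add_comm q p)

theorem HH.mk_comp_eq {p q n m : ℕ} (α : HH k A p) (β : HH k A q) (hn : q + p = n)
    (hm : q + p = m) :
    (GradedMonoid.mk n (Ext.comp (X := regularBimodule k A) (Y := regularBimodule k A)
      (Z := regularBimodule k A) β α hn : HH k A n) : GradedMonoid (HH k A)) =
    GradedMonoid.mk m (Ext.comp (X := regularBimodule k A) (Y := regularBimodule k A)
      (Z := regularBimodule k A) β α hm : HH k A m) := by
  subst hn hm
  rfl

instance : GradedMonoid.GOne (HH k A) := ⟨HH.one⟩

instance : GradedMonoid.GMul (HH k A) := ⟨fun α β => HH.mul α β⟩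

theorem HH.mk_one_mul {p : ℕ} (α : HH k A p) :
    (GradedMonoid.mk (0 + p) (HH.mul HH.one α) : GradedMonoid (HH k A)) = GradedMonoid.mk p α :=
  (HH.mk_comp_eq HH.one α (add_comm p 0) (add_zero p)).trans
    (congrArg (GradedMonoid.mk p) (Ext.comp_mk₀_id α))

theorem HH.mk_mul_one {p : ℕ} (α : HH k A p) :
    (GradedMonoid.mk (p + 0) (HH.mul α HH.one) : GradedMonoid (HH k A)) = GradedMonoid.mk p α :=
  (HH.mk_comp_eq α HH.one (add_comm 0 p) (zero_add p)).trans
    (congrArg (GradedMonoid.mk p) (Ext.mk₀_id_comp α))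

theorem HH.mk_mul_assoc {p q r : ℕ} (α : HH k A p) (β : HH k A q) (γ : HH k A r) :
    (GradedMonoid.mk (p + q + r) (HH.mul (HH.mul α β) γ) : GradedMonoid (HH k A)) =
      GradedMonoid.mk (p + (q + r)) (HH.mul α (HH.mul β γ)) := by
  refine (HH.mk_comp_eq (HH.mul α β) γ (add_comm r (p + q))
    (show r + (p + q) = p + (q + r) by omega)).trans ?_
  refine congrArg (GradedMonoid.mk (p + (q + r))) ?_
  exact (Ext.comp_assoc γ β α (add_comm r q) (add_comm q p)
    (show r + q + p = p + (q + r) by omega)).symm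

/-- The Yoneda product makes `HH^*(A)` a graded ring. -/
instance : DirectSum.GSemiring (HH k A) where
  mul_zero α := Ext.zero_comp (regularBimodule k A) _ α _ (add_comm _ _)
  zero_mul α := Ext.comp_zero α (regularBimodule k A) _ _ (add_comm _ _)
  mul_add α β γ := Ext.add_comp β γ α (add_comm _ _)
  add_mul α β γ := Ext.comp_add γ α β (add_comm _ _)
  one_mul := fun ⟨_, α⟩ => HH.mk_one_mul α
  mul_one := fun ⟨_, α⟩ => HH.mk_mul_one α
  mul_assoc := fun ⟨_, α⟩ ⟨_, β⟩ ⟨_, γ⟩ => HH.mk_mul_assoc α β γ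
  natCast n := n • HH.one
  natCast_zero := zero_smul _ _
  natCast_succ n := succ_nsmul _ n

theorem HH.smul_mul {p q : ℕ} (c : k) (α : HH k A p) (β : HH k A q) :
    HH.mul (c • α) β = c • HH.mul α β :=
  Ext.comp_smul β α _ c

theorem HH.mul_smul {p q : ℕ} (c : k) (α : HH k A p) (β : HH k A q) :
    HH.mul α (c • β) = c • HH.mul α β :=
  Ext.smul_comp β α _ c

theorem HH.mk_smul {p q : ℕ} (c : k) {α : HH k A p} {β : HH k A q}
    (h : GradedMonoid.mk p α = GradedMonoid.mk q β) :
    GradedMonoid.mk p (c • α) = GradedMonoid.mk q (c • β) := by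
  cases h
  rfl

variable (k A) in
/-- The structure map `k → HH^0(A)` of the graded algebra `HH^*(A)`. -/
def HH.ofScalar : k →+ HH k A 0 where
  toFun c := c • HH.one
  map_zero' := zero_smul k HH.one
  map_add' c d := add_smul c d HH.one

theorem HH.mk_ofScalar_mul {p : ℕ} (r : k) (α : HH k A p) :
    (GradedMonoid.mk (0 + p) (HH.mul (HH.ofScalar k A r) α) : GradedMonoid (HH k A)) =
      GradedMonoid.mk p (r • α) :=
  (congrArg (GradedMonoid.mk (0 + p)) (HH.smul_mul r HH.one α)).trans
    (HH.mk_smul r (HH.mk_one_mul α))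

theorem HH.mk_mul_ofScalar {p : ℕ} (r : k) (α : HH k A p) :
    (GradedMonoid.mk (p + 0) (HH.mul α (HH.ofScalar k A r)) : GradedMonoid (HH k A)) =
      GradedMonoid.mk p (r • α) :=
  (congrArg (GradedMonoid.mk (p + 0)) (HH.mul_smul r α HH.one)).trans
    (HH.mk_smul r (HH.mk_mul_one α))

/-- The Yoneda product is bilinear over `k`, and makes `HH^*(A)` a graded `k`-algebra. -/
instance : DirectSum.GAlgebra k (HH k A) where
  toFun := HH.ofScalar k A
  map_one := one_smul k (HH.one : HH k A 0)
  map_mul := fun r s =>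
    (congrArg (GradedMonoid.mk 0) (SemigroupAction.mul_smul r s (HH.one : HH k A 0))).trans
      (HH.mk_ofScalar_mul r (HH.ofScalar k A s)).symm
  commutes := fun r ⟨_, α⟩ => (HH.mk_ofScalar_mul r α).trans (HH.mk_mul_ofScalar r α).symm
  smul_def := fun r ⟨_, α⟩ => (HH.mk_ofScalar_mul r α).symm

end Cohomology

/-! ### The maps of the long exact sequence -/

section Maps

variable {k : Type u} [Field k] {A B : Type v} [Ring A] [Algebra k A] [Ring B] [Algebra k B]
  (φ : A →ₐ[k] B)

/-- The map `H^p(A, I) → HH^p(A)` induced by the inclusion `I ⟶ A`. -/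
def inclusionMap (p : ℕ) : HochschildCohomology k A (kerBimodule φ) p →ₗ[k] HH k A p :=
  (Ext.mk₀ (kerInclusion φ)).postcompOfLinear k (regularBimodule k A) (add_zero p)

/-- The map `HH^p(A) → H^p(A, B)` induced by `φ : A ⟶ B`. -/
def targetMap (p : ℕ) : HH k A p →ₗ[k] HochschildCohomology k A (targetBimodule φ) p :=
  (Ext.mk₀ (bimoduleMap φ)).postcompOfLinear k (regularBimodule k A) (add_zero p)

/-- The connecting map `H^p(A, B) → H^{p+1}(A, I)` of the short exact sequence
`0 ⟶ I ⟶ A ⟶ B ⟶ 0`. -/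
def connectingMap (hφ : Function.Surjective φ) (p : ℕ) :
    HochschildCohomology k A (targetBimodule φ) p →ₗ[k]
      HochschildCohomology k A (kerBimodule φ) (p + 1) :=
  (kerSequence_shortExact φ hφ).extClass.postcompOfLinear k (regularBimodule k A) rfl

/-- The natural map `HH^p(B) → H^p(A, B)`: restriction of scalars
`Ext_{B^e}^p(B, B) → Ext_{A^e}^p(B, B)` followed by composition with `φ : A ⟶ B`. -/
def changeOfRings (p : ℕ) : HH k B p →ₗ[k] HochschildCohomology k A (targetBimodule φ) p :=
  ((Ext.mk₀ (bimoduleMap φ)).precompOfLinear k (targetBimodule φ) (zero_add p)).comp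
    ((restrictBimodule φ).mapExtLinearMap k (regularBimodule k B) (regularBimodule k B) p)

end Maps

end Hochschild

end

open Hochschild

/-!
The maps `c_p : HH^p(B) → H^p(A, B)` are members of a family of maps
`Ext_{B^e}^p(B, N) → Ext_{A^e}^p(A, N)`, natural in the `B`-bimodule `N` and compatible with
connecting maps. By dimension shift (`bijective_comp_mapExactFunctor`) all of them are bijective once
they are bijective for `p = 0`, which only uses that `φ` is surjective (`bijective_comp_restrict`),
and every `N` embeds in a bimodule that is acyclic for both theories.

The acyclic bimodule is `Hom_k(B, N)`, with `N` embedded by `n ↦ (b ↦ n * b)`. It is acyclic because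
of the classical isomorphism `Ext_{A^e}^p(A, Hom_k(X, Y)) ≅ Ext_A^p(X, Y)` for left modules `X`, `Y`
over an algebra over a field, of which only the vanishing is needed
(`subsingleton_ext_homBimodule`). Over `B` this reduces acyclicity to `Ext_B^p(B, N) = 0`, and over
`A` to `Ext_A^p(B, N) = 0` for `p > 0`. The latter is where the homological epimorphism enters:
fullness on bounded derived categories makes `Ext_A^p(B, N)` a quotient of `Ext_B^p(B, N) = 0`
(`IsHomologicalEpi.subsingleton_ext`).

The vanishing of `Ext_{A^e}^p(A, Hom_k(X, Y))` is proved by dimension shift in `X` along a free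
presentation, which `Hom_k(-, Y)` turns into a short exact sequence of bimodules. For `X` free, it
holds since `A` and its syzygies over `A^e` are projective as left `A`-modules
(`subsingleton_ext_homBimodule_finsupp`).

With `c_p` bijective, `HH^p(A) → HH^p(B)` is the map to `H^p(A, B)` followed by the inverse of `c_p`.
Exactness is that of the covariant `Ext` sequence, and multiplicativity follows by moving `φ` through
a product one factor at a time (`changeOfRings_mul`).
-/

namespace Hochschild

noncomputable section

open Limits

/-! ### Comparison of `Ext` groups along an exact functor -/

section

universe w w' v₁ v₂ u₁ u₂ t t'

variable {C : Type u₁} [Category.{v₁} C] [Abelian C] {D : Type u₂} [Category.{v₂} D] [Abelian D]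
  (F : C ⥤ D) [F.Additive] [PreservesFiniteLimits F] [PreservesFiniteColimits F]

/-- Fullness on bounded derived categories is fullness on all `Ext` groups: a class in
`Ext^n(F X, F Y)` is a morphism `F X ⟶ F Y[n]` in the derived category, and both `X` and `Y[n]`
are bounded. -/
theorem mapExactFunctor_surjective_of_full [HasExt.{w} C] [HasExt.{w'} D]
    [HasDerivedCategory.{t} C] [HasDerivedCategory.{t'} D]
    (h : (mapBoundedDerivedCategory F).Full) (X Y : C) (n : ℕ) :
    Function.Surjective
      (Ext.mapExactFunctor F : Ext.{w} X Y n → Ext.{w'} (F.obj X) (F.obj Y) n) := by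
  intro e
  let X' : DerivedCategory.Bounded C := ⟨(DerivedCategory.singleFunctor C 0).obj X,
    ⟨0, inferInstance⟩, ⟨0, inferInstance⟩⟩
  let Y' : DerivedCategory.Bounded C := ⟨((DerivedCategory.singleFunctor C 0).obj Y)⟦(n : ℤ)⟧,
    ObjectProperty.le_shift _ (n : ℤ) _ ⟨⟨0, inferInstance⟩, ⟨0, inferInstance⟩⟩⟩
  -- `e.hom` transported along the isomorphisms `D(F)(X[0]) ≅ (F X)[0]` and
  -- `D(F)(Y[n]) ≅ (F Y)[n]`.
  let f : F.mapDerivedCategory.obj X'.obj ⟶ F.mapDerivedCategory.obj Y'.obj :=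
    (F.mapDerivedCategorySingleFunctor 0).hom.app X ≫ e.hom ≫
      ((F.mapDerivedCategorySingleFunctor 0).inv.app Y)⟦(n : ℤ)⟧' ≫
      (F.mapDerivedCategory.commShiftIso (n : ℤ)).inv.app _
  obtain ⟨g, hg⟩ := h.map_surjective (X := X') (Y := Y') (ObjectProperty.homMk f)
  have hg' : F.mapDerivedCategory.map g.hom = f := congrArg (·.hom) hg
  have hhom : (Ext.homEquiv.symm g.hom).hom = g.hom := Ext.homEquiv.apply_symm_apply _
  refine ⟨Ext.homEquiv.symm g.hom, Ext.ext ?_⟩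
  rw [Ext.mapExactFunctor_hom, hhom, ShiftedHom.map]
  erw [hg']
  dsimp only [f]
  simp only [Category.assoc, Functor.comp_obj]
  erw [Iso.inv_hom_id_app_assoc, Iso.inv_hom_id_app_assoc, ← Functor.map_comp,
    Iso.inv_hom_id_app, CategoryTheory.Functor.map_id, Category.comp_id]

variable {F}
variable [HasExt.{w} C] [HasExt.{w'} D]

/-- A comparison of universal `δ`-functors. The maps `Ext^p(X, N) ⟶ Ext^p(X', F N)` given by an
exact functor `F` and a morphism `b : X' ⟶ F X` are bijective in all degrees as soon as they are
bijective in degree `0` and every `N` embeds in an object acyclic for both theories. -/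
theorem bijective_comp_mapExactFunctor {X : C} {X' : D} (b : X' ⟶ F.obj X)
    (h0 : ∀ N : C, Function.Bijective fun f : X ⟶ N => b ≫ F.map f)
    (hJ : ∀ N : C, ∃ (J : C) (i : N ⟶ J), Mono i ∧ (∀ p, Subsingleton (Ext.{w} X J (p + 1))) ∧
      ∀ p, Subsingleton (Ext.{w'} X' (F.obj J) (p + 1))) (p : ℕ) (N : C) :
    Function.Bijective fun x : Ext.{w} X N p =>
      (Ext.mk₀ b).comp (x.mapExactFunctor F) (zero_add p) := by
  induction p generalizing N with
  | zero =>
    convert ((Ext.mk₀_bijective X' (F.obj N)).comp (h0 N)).comp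
      (Ext.homEquiv₀ (X := X) (Y := N)).bijective using 1
    ext x
    obtain ⟨f, rfl⟩ := (Ext.mk₀_bijective X N).2 x
    have : Ext.homEquiv₀ (Ext.mk₀ f) = f := Ext.homEquiv₀.symm_apply_eq.1 rfl |>.symm
    simp only [Function.comp_apply, this]
    exact (congrArg (fun y => (Ext.mk₀ b).comp y (zero_add 0))
      (Ext.mapExactFunctor_mk₀ F f)).trans (Ext.mk₀_comp_mk₀ b (F.map f))
  | succ p ih =>
    obtain ⟨J, i, hi, hJ₁, hJ₂⟩ := hJ N
    let S : ShortComplex C := ShortComplex.mk i (cokernel.π i) (cokernel.condition i)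
    have hS : S.ShortExact :=
      { exact := ShortComplex.exact_of_g_is_cokernel _ (cokernelIsCokernel S.f) }
    have hFS := hS.map_of_exact F
    -- Both connecting maps `Ext^p(-, S.X₃) ⟶ Ext^{p+1}(-, N)` are surjective, so the comparison in
    -- degree `p + 1` for `N` is induced by the one in degree `p` for `S.X₃`.
    have key (y : Ext.{w} X S.X₃ p) :
        (Ext.mk₀ b).comp ((y.comp hS.extClass rfl).mapExactFunctor F) (zero_add (p + 1)) =
          ((Ext.mk₀ b).comp (y.mapExactFunctor F) (zero_add p)).comp hFS.extClass rfl := by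
      rw [Ext.mapExactFunctor_comp, Ext.mapExactFunctor_extClass]
      exact (Ext.comp_assoc (Ext.mk₀ b) (y.mapExactFunctor F) hFS.extClass (zero_add p) rfl
        (by omega)).symm
    refine ⟨?_, fun x => ?_⟩
    · refine (injective_iff_map_eq_zero (((Ext.mk₀ b).precomp _ (zero_add _)).comp
        (F.mapExtAddHom X N (p + 1)))).2 fun x hx => ?_
      obtain ⟨y, rfl⟩ := Ext.covariant_sequence_exact₁ X hS x (Subsingleton.elim (h := hJ₁ p) _ _)
        rfl
      obtain ⟨z, hz⟩ := Ext.covariant_sequence_exact₃ X' hFS _ rfl ((key y).symm.trans hx)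
      obtain ⟨w, rfl⟩ := (ih J).2 z
      have : w.comp (Ext.mk₀ S.g) (add_zero p) = y := by
        apply (ih S.X₃).1
        refine Eq.trans ?_ hz
        dsimp only
        rw [Ext.mapExactFunctor_comp, Ext.mapExactFunctor_mk₀]
        exact (Ext.comp_assoc (Ext.mk₀ b) (w.mapExactFunctor F) (Ext.mk₀ (F.map S.g)) (zero_add p)
          (add_zero p) (by omega)).symm
      rw [← this, Ext.comp_assoc _ _ _ (add_zero p) (zero_add 1) (by omega), hS.comp_extClass,
        Ext.comp_zero]
    · obtain ⟨y, rfl⟩ := Ext.covariant_sequence_exact₁ X' hFS x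
        (Subsingleton.elim (h := hJ₂ p) _ _) rfl
      obtain ⟨z, rfl⟩ := (ih S.X₃).2 y
      exact ⟨z.comp hS.extClass rfl, key z⟩

/-- Vanishing of `Ext^{p+1}(M, Y)` by dimension shift in `M`, within a class `Q` of objects which
is stable under syzygies and for which morphisms from a syzygy to `Y` extend to the projective. -/
theorem subsingleton_ext_of_extends [EnoughProjectives C] (Y : C) (Q : C → Prop)
    (hQ : ∀ S : ShortComplex C, S.ShortExact → Projective S.X₂ → Q S.X₃ →
      Q S.X₁ ∧ ∀ f : S.X₁ ⟶ Y, ∃ g : S.X₂ ⟶ Y, S.f ≫ g = f) (p : ℕ) (M : C) (hM : Q M) :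
    Subsingleton (Ext.{w} M Y (p + 1)) := by
  let S := ShortComplex.mk _ _ (kernel.condition (Projective.π M))
  have hS : S.ShortExact :=
    { exact := ShortComplex.exact_of_f_is_kernel _ (kernelIsKernel S.g) }
  have hP : Projective S.X₂ := inferInstanceAs (Projective (Projective.over M))
  obtain ⟨hK, hext⟩ := hQ S hS hP hM
  refine subsingleton_of_forall_eq 0 fun x => ?_
  obtain ⟨y, rfl⟩ := Ext.contravariant_sequence_exact₃ hS Y x (Ext.eq_zero_of_projective _)
    (add_comm 1 p)
  cases p with
  | zero =>
    obtain ⟨f, rfl⟩ := (Ext.mk₀_bijective _ _).2 y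
    obtain ⟨g, rfl⟩ := hext f
    rw [← Ext.mk₀_comp_mk₀, ← Ext.comp_assoc _ _ _ (add_zero 1) (add_zero 0) (by omega),
      hS.extClass_comp, Ext.zero_comp]
  | succ p =>
    have := subsingleton_ext_of_extends Y Q hQ p S.X₁ hK
    rw [Subsingleton.elim y 0, Ext.comp_zero]

end

section

/-! ### Bimodules of linear maps -/

variable {k : Type u} [Field k] {A : Type v} [Ring A] [Algebra k A]

section
variable (X Y : ModuleCat.{v} A)

/-- The action of `A` on `Hom_k(X, Y)` through `Y`: `(a • f) x = a • f x`. -/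
def homLeftAction : A →ₐ[k] Module.End k (X →ₗ[k] Y) := Algebra.lsmul k k (X →ₗ[k] Y)

/-- The right action of `A` on `Hom_k(X, Y)` through `X`: `(f • b) x = f (b • x)`. -/
def homRightAction : Aᵐᵒᵖ →ₐ[k] Module.End k (X →ₗ[k] Y) :=
  AlgHom.ofLinearMap
    { toFun b := LinearMap.lcomp k Y (Algebra.lsmul k k X b.unop)
      map_add' b c := by ext; simp
      map_smul' b c := by ext; simp }
    (by ext; simp) (fun b c => by ext; simp)

/-- The two commuting actions of `A` on `Hom_k(X, Y)`, as an action of the enveloping algebra. -/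
def homAction : Env k A →ₐ[k] Module.End k (X →ₗ[k] Y) :=
  Algebra.TensorProduct.lift (homLeftAction X Y) (homRightAction X Y) fun a b => by
    ext; simp [homLeftAction, homRightAction]

variable (k) in
/-- For left `A`-modules `X` and `Y`, the vector space `Hom_k(X, Y)` as an `A`-bimodule:
`((a ⊗ b) • f) x = a • f (b • x)`. The `k`-structures of `X` and `Y` are those obtained from their
`A`-structures, even if they carry others. -/
def homBimodule : ModuleCat.{v} (Env k A) :=
  letI := Module.compHom (X →ₗ[k] Y) (homAction (k := k) X Y).toRingHom
  ModuleCat.of (Env k A) (X →ₗ[k] Y)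

variable {X Y} in
/-- The linear map underlying an element of `Hom_k(X, Y)`. -/
def homBimodule.toLinearMap (f : homBimodule k X Y) : X →ₗ[k] Y := f

variable {X Y} in
/-- An additive map compatible with scalars, as an element of `Hom_k(X, Y)`. Compatibility is stated
with `algebraMap k A`, so that no `k`-module structure on `X` or `Y` needs to be chosen. -/
def homBimodule.mk (f : X →+ Y)
    (hf : ∀ (t : k) (x : X), f (algebraMap k A t • x) = algebraMap k A t • f x) :
    homBimodule k X Y :=
  ({ toFun := f, map_add' := map_add f, map_smul' := hf } : X →ₗ[k] Y)

variable {X Y}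

open homBimodule

theorem homBimodule_ext {f g : homBimodule k X Y} (h : ∀ x, toLinearMap f x = toLinearMap g x) :
    f = g := LinearMap.ext (f := toLinearMap f) (g := toLinearMap g) h

theorem homBimodule_add_apply (f g : homBimodule k X Y) (x : X) :
    toLinearMap (f + g) x = toLinearMap f x + toLinearMap g x := rfl

theorem homBimodule_tmul_smul (a : A) (b : Aᵐᵒᵖ) (f : homBimodule k X Y) (x : X) :
    toLinearMap ((a ⊗ₜ[k] b : Env k A) • f) x = a • toLinearMap f (b.unop • x) := rfl

theorem regularBimodule_tmul_smul (a : A) (b : Aᵐᵒᵖ) (m : A) :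
    ((a ⊗ₜ[k] b : Env k A) • (show regularBimodule k A from m) : regularBimodule k A) =
      a * m * b.unop :=
  (TensorProduct.Algebra.moduleAux_apply a b m).trans (mul_assoc a m b.unop).symm

/-- A morphism of bimodules, from an additive map which commutes with the action of pure tensors. -/
def envHom {M N : ModuleCat.{v} (Env k A)} (f : M →+ N)
    (hf : ∀ (a : A) (b : Aᵐᵒᵖ) (m : M), f ((a ⊗ₜ[k] b : Env k A) • m) =
      (a ⊗ₜ[k] b : Env k A) • f m) : M ⟶ N :=
  ModuleCat.ofHom
    { toFun := f
      map_add' := map_add f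
      map_smul' x m := by
        induction x using TensorProduct.induction_on with
        | zero =>
          exact ((congrArg f (zero_smul (Env k A) m)).trans (map_zero f)).trans
            (zero_smul (Env k A) (f m)).symm
        | tmul a b => exact hf a b m
        | add x y hx hy => simp only [add_smul, map_add, hx, hy, RingHom.id_apply] }

end

variable (k A) in
/-- The functor from `A`-bimodules to left `A`-modules which forgets the right action. -/
abbrev leftModule : ModuleCat.{v} (Env k A) ⥤ ModuleCat.{v} A :=
  ModuleCat.restrictScalars (Algebra.TensorProduct.includeLeft : A →ₐ[k] Env k A).toRingHom

theorem tmul_one_smul (a : A) (z : Env k A) : (a ⊗ₜ[k] (1 : Aᵐᵒᵖ) : Env k A) * z = a • z := by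
  induction z using TensorProduct.induction_on with
  | zero => simp
  | tmul b c => simp [TensorProduct.smul_tmul']
  | add x y hx hy => rw [mul_add, smul_add, hx, hy]

/-- A projective bimodule is projective as a left module: `A ⊗ A^op` is free over `A`, because
`A^op` is free over the field `k`. -/
theorem projective_leftModule (P : ModuleCat.{v} (Env k A)) [hP : Projective P] :
    Projective ((leftModule k A).obj P) := by
  rw [← IsProjective.iff_projective]
  have hP' : Module.Projective (Env k A) P := (IsProjective.iff_projective _).2 hP
  obtain ⟨s, hs⟩ := hP'.out
  have : Module.Free A (Env k A) :=
    .of_basis (Algebra.TensorProduct.basis A (Module.Basis.ofVectorSpace k Aᵐᵒᵖ))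
  let s' : ((leftModule k A).obj P) →ₗ[A] (P →₀ Env k A) :=
    { toFun := s
      map_add' := map_add s
      map_smul' a x := by
        refine (map_smul s (a ⊗ₜ[k] (1 : Aᵐᵒᵖ) : Env k A) x).trans ?_
        ext y
        exact tmul_one_smul a _ }
  let t' : (P →₀ Env k A) →ₗ[A] ((leftModule k A).obj P) :=
    { toFun := Finsupp.linearCombination (Env k A) id
      map_add' := map_add _
      map_smul' a x := by
        have : a • x = (a ⊗ₜ[k] (1 : Aᵐᵒᵖ) : Env k A) • x := by
          ext y
          exact (tmul_one_smul a _).symm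
        rw [this, map_smul]
        rfl }
  exact Module.Projective.of_split s' t' (LinearMap.ext hs)

theorem projective_regular : Projective ((leftModule k A).obj (regularBimodule k A)) := by
  rw [← IsProjective.iff_projective]
  let e : A →ₗ[A] (leftModule k A).obj (regularBimodule k A) :=
    { toFun a := a
      map_add' _ _ := rfl
      map_smul' a x := ((regularBimodule_tmul_smul (k := k) a (1 : Aᵐᵒᵖ) x).trans
        (mul_one (a * x))).symm }
  exact Module.Projective.of_equiv' (LinearEquiv.ofBijective e Function.bijective_id)

/-! ### Bimodules of linear maps out of a free module are acyclic -/

open homBimodule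

section
variable {P : ModuleCat.{v} (Env k A)} {Y : ModuleCat.{v} A}

/-- A left linear map `φ : P → Y` on a bimodule, evaluated along the right action:
`c ↦ φ (m * c)`. -/
def coordinateMap (φ : (leftModule k A).obj P →ₗ[A] Y) (m : P) : A →ₗ[k] Y where
  toFun c := φ ((1 ⊗ₜ[k] MulOpposite.op c : Env k A) • m : P)
  map_add' c d := by
    rw [MulOpposite.op_add, TensorProduct.tmul_add, add_smul]
    exact map_add φ _ _
  map_smul' t c := by
    have : (1 ⊗ₜ[k] MulOpposite.op (t • c) : Env k A) =
        (algebraMap k A t ⊗ₜ[k] (1 : Aᵐᵒᵖ) : Env k A) * (1 ⊗ₜ[k] MulOpposite.op c : Env k A) := by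
      simp only [Algebra.TensorProduct.tmul_mul_tmul, mul_one, one_mul, smul_mul_assoc,
        Algebra.algebraMap_eq_smul_one, TensorProduct.smul_tmul, MulOpposite.op_smul]
    rw [this, SemigroupAction.mul_smul]
    exact (map_smul φ (algebraMap k A t) _).trans (algebraMap_smul A t _)

theorem coordinateMap_zero (φ : (leftModule k A).obj P →ₗ[A] Y) (c : A) :
    coordinateMap φ (0 : P) c = 0 :=
  (congrArg φ (smul_zero _)).trans (map_zero φ)

theorem coordinateMap_add (φ : (leftModule k A).obj P →ₗ[A] Y) (m n : P) (c : A) :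
    coordinateMap φ (m + n) c = coordinateMap φ m c + coordinateMap φ n c :=
  (congrArg φ (smul_add _ m n)).trans (map_add φ _ _)

theorem coordinateMap_tmul_smul (φ : (leftModule k A).obj P →ₗ[A] Y) (a : A) (b : Aᵐᵒᵖ) (m : P)
    (c : A) :
    coordinateMap φ ((a ⊗ₜ[k] b : Env k A) • m : P) c = a • coordinateMap φ m (b.unop * c) := by
  refine Eq.trans (congrArg φ ?_) (map_smul φ a _)
  refine Eq.trans ?_ (SemigroupAction.mul_smul (a ⊗ₜ[k] (1 : Aᵐᵒᵖ) : Env k A) _ m)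
  rw [← SemigroupAction.mul_smul, Algebra.TensorProduct.tmul_mul_tmul,
    Algebra.TensorProduct.tmul_mul_tmul]
  simp only [one_mul, mul_one, MulOpposite.op_mul, MulOpposite.op_unop]
  rfl

variable {ι : Type v} (φ : ι → ((leftModule k A).obj P →ₗ[A] Y))

/-- The linear map `∑ cᵢ eᵢ ↦ ∑ φᵢ (m * cᵢ)` on the free left module with basis `eᵢ`. -/
def coinduceFun (m : P) : homBimodule k (ModuleCat.of A (ι →₀ A)) Y :=
  homBimodule.mk (X := ModuleCat.of A (ι →₀ A))
    (Finsupp.lsum k (fun i => coordinateMap (φ i) m)).toAddMonoidHom fun t x =>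
      (congrArg (Finsupp.lsum k (fun i => coordinateMap (φ i) m))
        (algebraMap_smul A t (show ι →₀ A from x))).trans
        ((map_smul (Finsupp.lsum k (fun i => coordinateMap (φ i) m)) t x).trans
          (algebraMap_smul A t _).symm)

theorem coinduceFun_single (m : P) (i : ι) (c : A) :
    toLinearMap (coinduceFun φ m) (Finsupp.single i c) =
      coordinateMap (φ i) m c :=
  Finsupp.lsum_single k (fun i => coordinateMap (φ i) m) i c

theorem homBimodule_finsupp_ext {f g : homBimodule k (ModuleCat.of A (ι →₀ A)) Y}
    (h : ∀ (i : ι) (c : A), toLinearMap f (Finsupp.single i c) =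
      toLinearMap g (Finsupp.single i c)) : f = g :=
  homBimodule_ext fun x => DFunLike.congr_fun (Finsupp.addHom_ext (M := A)
    (f := (toLinearMap f).toAddMonoidHom) (g := (toLinearMap g).toAddMonoidHom) h) x

/-- The bimodule morphism `P ⟶ Hom_k(A^(ι), Y)` that corresponds to a family of left linear maps
`φᵢ : P → Y`: it sends `m` to `∑ cᵢ eᵢ ↦ ∑ φᵢ (m * cᵢ)`. -/
def coinduce : P ⟶ homBimodule k (ModuleCat.of A (ι →₀ A)) Y :=
  envHom
    { toFun m := coinduceFun φ m
      map_zero' := homBimodule_finsupp_ext fun i c => by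
        rw [coinduceFun_single]
        exact coordinateMap_zero (φ i) c
      map_add' m n := homBimodule_finsupp_ext fun i c => by
        rw [homBimodule_add_apply, coinduceFun_single, coinduceFun_single, coinduceFun_single]
        exact coordinateMap_add (φ i) m n c }
    (fun a b m => homBimodule_finsupp_ext fun i c => by
      refine (coinduceFun_single φ _ i c).trans ((coordinateMap_tmul_smul (φ i) a b m c).trans ?_)
      refine congrArg (a • ·) ((coinduceFun_single φ m i (b.unop * c)).symm.trans ?_)
      exact congrArg (toLinearMap (coinduceFun φ m)) (Finsupp.smul_single b.unop i c).symm)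

end

/-- If `M` is projective as a left module, then `Hom_k(F, Y)` is acyclic for `Ext_{A^e}(M, -)` when
`F` is free. A bimodule morphism into `Hom_k(F, Y)` amounts to a family of left linear maps into
`Y`, and these extend from a syzygy of `M` because the syzygy is a direct summand as a left
module. -/
theorem subsingleton_ext_homBimodule_finsupp (ι : Type v) (Y : ModuleCat.{v} A)
    (M : ModuleCat.{v} (Env k A)) (hM : Projective ((leftModule k A).obj M)) (p : ℕ) :
    Subsingleton (Ext.{v} M (homBimodule k (ModuleCat.of A (ι →₀ A)) Y) (p + 1)) := by
  refine subsingleton_ext_of_extends _ (fun M => Projective ((leftModule k A).obj M)) ?_ p M hM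
  intro S hS hP hM
  have : Projective ((leftModule k A).obj S.X₂) := projective_leftModule _
  have : Projective (S.map (leftModule k A)).X₃ := hM
  let σ := (hS.map_of_exact (leftModule k A)).splittingOfProjective
  let r : (leftModule k A).obj S.X₂ →ₗ[A] (leftModule k A).obj S.X₁ := σ.r.hom
  have hr : ∀ n : S.X₁, r (S.f n) = n := fun n => congrArg (fun f => f.hom n) σ.f_r
  refine ⟨Retract.projective (Y := (leftModule k A).obj S.X₂)
    ⟨((leftModule k A).map S.f), σ.r, σ.f_r⟩, fun f => ?_⟩
  -- The coordinate `εᵢ n = f n (eᵢ)` of `f`.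
  let ε (i : ι) : (leftModule k A).obj S.X₁ →ₗ[A] Y :=
    { toFun n := toLinearMap (f (show S.X₁ from n)) (Finsupp.single i 1)
      map_add' n m := by
        refine (congrArg (fun g => toLinearMap g (Finsupp.single i 1)) (map_add f.hom _ _)).trans ?_
        rfl
      map_smul' a n := by
        refine (congrArg (fun g => toLinearMap g (Finsupp.single i 1))
          (map_smul f.hom (a ⊗ₜ[k] (1 : Aᵐᵒᵖ) : Env k A) (show S.X₁ from n))).trans ?_
        refine (homBimodule_tmul_smul a 1 (f n) _).trans ?_
        simp }
  refine ⟨coinduce fun i => ε i ∘ₗ r, ?_⟩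
  ext n
  refine homBimodule_finsupp_ext fun i c => (coinduceFun_single _ _ i c).trans ?_
  have h₁ : r ((1 ⊗ₜ[k] MulOpposite.op c : Env k A) • (S.f n : S.X₂) : S.X₂) =
      ((1 ⊗ₜ[k] MulOpposite.op c : Env k A) • n : S.X₁) :=
    (congrArg r (map_smul S.f.hom _ n).symm).trans (hr _)
  refine (congrArg (ε i) h₁).trans ?_
  refine (congrArg (fun g => toLinearMap g (Finsupp.single i 1)) (map_smul f.hom _ n)).trans ?_
  refine (homBimodule_tmul_smul 1 (MulOpposite.op c) (f n) _).trans ((one_smul A _).trans ?_)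
  refine congrArg (toLinearMap (f n)) ((Finsupp.smul_single c i (1 : A)).trans ?_)
  rw [smul_eq_mul, mul_one]

end

section

/-! ### Exactness of linear maps in the first variable -/

open homBimodule

variable {k : Type u} [Field k] {A : Type v} [Ring A] [Algebra k A]

variable (k) in
/-- Composition with `g : X ⟶ X'`, as a bimodule morphism `Hom_k(X', Y) ⟶ Hom_k(X, Y)`. -/
def homBimodule.precomp {X X' : ModuleCat.{v} A} (g : X ⟶ X') (Y : ModuleCat.{v} A) :
    homBimodule k X' Y ⟶ homBimodule k X Y :=
  envHom
    { toFun f := (toLinearMap f).comp (g.hom.restrictScalars k)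
      map_zero' := homBimodule_ext fun _ => rfl
      map_add' _ _ := homBimodule_ext fun _ => rfl }
    fun a b f => homBimodule_ext fun x =>
      congrArg (fun y => a • toLinearMap f y) (map_smul g.hom b.unop x).symm

/-- `Hom_k(-, Y)` is exact, since short exact sequences split over the field `k`. -/
theorem precomp_shortExact {S : ShortComplex (ModuleCat.{v} A)} (hS : S.ShortExact)
    (Y : ModuleCat.{v} A) :
    (ShortComplex.mk (precomp k S.g Y) (precomp k S.f Y) (by
      ext f
      exact homBimodule_ext fun x => (congrArg (toLinearMap f)
        (congrArg (fun h => h.hom x) S.zero)).trans (map_zero (toLinearMap f)))).ShortExact := by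
  have hf : Function.Injective S.f := (ModuleCat.mono_iff_injective _).1 hS.mono_f
  have hg : Function.Surjective S.g := (ModuleCat.epi_iff_surjective _).1 hS.epi_g
  have hfg : Function.Exact S.f S.g :=
    (ShortComplex.ShortExact.moduleCat_exact_iff_function_exact _).1 hS.exact
  refine
    { exact := ?_
      mono_f := (ModuleCat.mono_iff_injective _).2 ?_
      epi_g := (ModuleCat.epi_iff_surjective _).2 ?_ }
  · rw [ShortComplex.ShortExact.moduleCat_exact_iff_function_exact]
    intro f
    constructor
    · intro h
      obtain ⟨s, hs⟩ := LinearMap.exists_rightInverse_of_surjective (S.g.hom.restrictScalars k)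
        (LinearMap.range_eq_top.2 hg)
      have hs' (x : S.X₃) : S.g (s x) = x := LinearMap.congr_fun hs x
      refine ⟨(toLinearMap f).comp s, homBimodule_ext fun x => ?_⟩
      obtain ⟨z, hz⟩ := (hfg (s (S.g x) - x)).1
        ((map_sub S.g.hom _ _).trans (sub_eq_zero.2 (hs' (S.g x))))
      refine sub_eq_zero.1 ((map_sub (toLinearMap f) (s (S.g x)) x).symm.trans ?_)
      rw [← hz]
      exact LinearMap.congr_fun (congrArg toLinearMap h) z
    · rintro ⟨f, rfl⟩
      exact homBimodule_ext fun x => (congrArg (toLinearMap f)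
        (congrArg (fun h => h.hom x) S.zero)).trans (map_zero (toLinearMap f))
  · intro f f' h
    refine homBimodule_ext fun x => ?_
    obtain ⟨x, rfl⟩ := hg x
    exact LinearMap.congr_fun (congrArg toLinearMap h) x
  · intro f
    obtain ⟨r, hr⟩ := LinearMap.exists_leftInverse_of_injective (S.f.hom.restrictScalars k)
      (LinearMap.ker_eq_bot.2 hf)
    exact ⟨(toLinearMap f).comp r, homBimodule_ext fun x =>
      congrArg (toLinearMap f) (LinearMap.congr_fun hr x)⟩

/-! ### Morphisms out of the regular bimodule -/

variable {X Y : ModuleCat.{v} A}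

theorem regularBimodule_hom_apply {M : ModuleCat.{v} (Env k A)} (f : regularBimodule k A ⟶ M)
    (a : A) : f a = (a ⊗ₜ[k] (1 : Aᵐᵒᵖ) : Env k A) • f (1 : A) := by
  refine Eq.trans (congrArg f ?_) (map_smul f.hom _ _)
  exact (((regularBimodule_tmul_smul a (1 : Aᵐᵒᵖ) 1).trans (mul_one (a * 1 : A))).trans
    (mul_one a)).symm

theorem regularBimodule_hom_apply' {M : ModuleCat.{v} (Env k A)} (f : regularBimodule k A ⟶ M)
    (a : A) : f a = (1 ⊗ₜ[k] MulOpposite.op a : Env k A) • f (1 : A) := by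
  refine Eq.trans (congrArg f ?_) (map_smul f.hom _ _)
  refine Eq.symm ((regularBimodule_tmul_smul 1 (MulOpposite.op a) 1).trans ?_)
  rw [mul_one, one_mul]
  rfl

theorem regularBimodule_hom_ext {M : ModuleCat.{v} (Env k A)} {f g : regularBimodule k A ⟶ M}
    (h : f (1 : A) = g (1 : A)) : f = g :=
  ModuleCat.hom_ext (LinearMap.ext fun a => by
    exact (regularBimodule_hom_apply f a).trans ((congrArg _ h).trans
      (regularBimodule_hom_apply g a).symm))

/-- A bimodule morphism `h : A ⟶ Hom_k(X, Y)` gives the `A`-linear map `h 1 : X ⟶ Y`; linearity is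
the centrality of `h 1`. -/
def homOfCentral (h : regularBimodule k A ⟶ homBimodule k X Y) : X ⟶ Y :=
  ModuleCat.ofHom
    { toFun := toLinearMap (h (1 : A))
      map_add' := map_add _
      map_smul' a x := by
        have := congrArg (fun f => toLinearMap f x)
          ((regularBimodule_hom_apply' h a).symm.trans (regularBimodule_hom_apply h a))
        refine (one_smul A _).symm.trans (this.trans ?_)
        exact congrArg (fun y => a • toLinearMap (h (1 : A)) y) (one_smul A x) }

/-- The bimodule morphism `A ⟶ M`, `a ↦ a * n`, for an element `n` of `M` such that
`a * n = n * a` for all `a`. -/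
def homOfCentralElement {M : ModuleCat.{v} (Env k A)} (n : M)
    (hn : ∀ a : A, (1 ⊗ₜ[k] MulOpposite.op a : Env k A) • n =
      (a ⊗ₜ[k] (1 : Aᵐᵒᵖ) : Env k A) • n) : regularBimodule k A ⟶ M :=
  envHom
    { toFun := fun a : A => (a ⊗ₜ[k] (1 : Aᵐᵒᵖ) : Env k A) • n
      map_zero' := (congrArg (· • n) (TensorProduct.zero_tmul A (1 : Aᵐᵒᵖ))).trans 
        (zero_smul (Env k A) n)
      map_add' := fun a b : A =>
        (congrArg (· • n) (TensorProduct.add_tmul a b (1 : Aᵐᵒᵖ))).trans 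
          (add_smul (R := Env k A) _ _ n) }
    fun a b (c : A) => by
      refine (congrArg (fun d : A => (d ⊗ₜ[k] (1 : Aᵐᵒᵖ) : Env k A) • n)
        (regularBimodule_tmul_smul a b c)).trans ?_
      have h₁ : ((a * c * b.unop : A) ⊗ₜ[k] (1 : Aᵐᵒᵖ) : Env k A) =
          ((a * c : A) ⊗ₜ[k] (1 : Aᵐᵒᵖ) : Env k A) * (b.unop ⊗ₜ[k] (1 : Aᵐᵒᵖ) : Env k A) := by
        rw [Algebra.TensorProduct.tmul_mul_tmul, mul_one]
      have h₂ : ((a * c : A) ⊗ₜ[k] (1 : Aᵐᵒᵖ) : Env k A) *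
          (1 ⊗ₜ[k] MulOpposite.op b.unop : Env k A) =
          (a ⊗ₜ[k] b : Env k A) * (c ⊗ₜ[k] (1 : Aᵐᵒᵖ) : Env k A) := by
        rw [Algebra.TensorProduct.tmul_mul_tmul, Algebra.TensorProduct.tmul_mul_tmul, mul_one,
          mul_one, one_mul, MulOpposite.op_unop]
      refine (congrArg (· • n) h₁).trans ?_
      rw [SemigroupAction.mul_smul, ← hn, ← SemigroupAction.mul_smul, h₂,
        SemigroupAction.mul_smul]
      rfl

theorem homOfCentralElement_one {M : ModuleCat.{v} (Env k A)} (n : M)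
    (hn : ∀ a : A, (1 ⊗ₜ[k] MulOpposite.op a : Env k A) • n =
      (a ⊗ₜ[k] (1 : Aᵐᵒᵖ) : Env k A) • n) : homOfCentralElement n hn (1 : A) = n :=
  one_smul (Env k A) n

/-- An `A`-linear map `w : X ⟶ Y` is a central element of `Hom_k(X, Y)`, hence a bimodule morphism
`A ⟶ Hom_k(X, Y)`. This is the inverse of `homOfCentral`. -/
def centralOfHom (w : X ⟶ Y) : regularBimodule k A ⟶ homBimodule k X Y :=
  homOfCentralElement (M := homBimodule k X Y) (w.hom.restrictScalars k) fun a =>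
    homBimodule_ext fun x => (one_smul A _).trans ((map_smul w.hom a x).trans
      (congrArg (fun y => a • w y) (one_smul A x)).symm)

theorem centralOfHom_one_apply (w : X ⟶ Y) (x : X) :
    toLinearMap (centralOfHom (k := k) w (1 : A)) x = w x :=
  congrArg (fun f => toLinearMap f x) (homOfCentralElement_one (M := homBimodule k X Y) _ _)

/-! ### Vanishing of cohomology with coefficients in linear maps -/

/-- The vanishing part of the isomorphism `Ext_{A^e}^*(A, Hom_k(X, Y)) ≅ Ext_A^*(X, Y)`. With
`0 ⟶ K ⟶ F ⟶ X ⟶ 0` exact and `F` free, both sides shift from `X` to `K`; in degree `1` both are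
the cokernel of `Hom_A(F, Y) ⟶ Hom_A(K, Y)`. -/
theorem subsingleton_ext_homBimodule (p : ℕ) (X Y : ModuleCat.{v} A)
    (h : Subsingleton (Ext.{v} X Y (p + 1))) :
    Subsingleton (Ext.{v} (regularBimodule k A) (homBimodule k X Y) (p + 1)) := by
  let π : ModuleCat.of A (X →₀ A) ⟶ X := ModuleCat.ofHom (Finsupp.linearCombination A id)
  have hπ : Epi π := (ModuleCat.epi_iff_surjective _).2
    (Finsupp.linearCombination_surjective A Function.surjective_id)
  let S := ShortComplex.mk _ _ (kernel.condition π)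
  have hS : S.ShortExact :=
    { exact := ShortComplex.exact_of_f_is_kernel _ (kernelIsKernel S.g) }
  have hP : Projective S.X₂ := (IsProjective.iff_projective (X →₀ A)).1 inferInstance
  have hT := precomp_shortExact (k := k) hS Y
  have hF (q : ℕ) (x : Ext.{v} (regularBimodule k A) (homBimodule k S.X₂ Y) (q + 1)) : x = 0 :=
    (subsingleton_ext_homBimodule_finsupp X Y _ projective_regular q).elim x 0
  refine subsingleton_of_forall_eq 0 fun x => ?_
  obtain ⟨y, rfl⟩ := Ext.covariant_sequence_exact₁ _ hT x (hF p _) rfl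
  cases p with
  | zero =>
    obtain ⟨f, rfl⟩ := (Ext.mk₀_bijective _ _).2 y
    -- `f` amounts to an `A`-linear map `K ⟶ Y`, and the obstruction to extending it to `F` lies in
    -- `Ext_A^1(X, Y) = 0`; the extension `w` gives a lift of `f` to `Hom_k(F, Y)`.
    obtain ⟨w, hw⟩ := Ext.contravariant_sequence_exact₁ hS Y (Ext.mk₀ (homOfCentral f))
      (add_comm 1 0) (h.elim _ _)
    obtain ⟨w, rfl⟩ := (Ext.mk₀_bijective _ _).2 w
    rw [Ext.mk₀_comp_mk₀] at hw
    have hw' := (Ext.mk₀_bijective _ _).1 hw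
    have : centralOfHom w ≫ precomp k S.f Y = f := by
      refine regularBimodule_hom_ext (homBimodule_ext fun x => ?_)
      refine (centralOfHom_one_apply w (S.f x)).trans ?_
      exact congrArg (fun f => f.hom x) hw'
    rw [← this, ← Ext.mk₀_comp_mk₀, Ext.comp_assoc _ _ _ (add_zero 0) (zero_add 1) (by omega)]
    exact (congrArg (fun z => (Ext.mk₀ _).comp z (zero_add 1)) hT.comp_extClass).trans
      (Ext.comp_zero _ _ _ _ _)
  | succ p =>
    have hK : Subsingleton (Ext.{v} S.X₁ Y (p + 1)) := subsingleton_of_forall_eq 0 fun z => by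
      obtain ⟨w, rfl⟩ := Ext.contravariant_sequence_exact₁ hS Y z (add_comm 1 (p + 1))
        (h.elim _ _)
      rw [Ext.eq_zero_of_projective w, Ext.comp_zero]
    have := subsingleton_ext_homBimodule p S.X₁ Y hK
    rw [this.elim y 0, Ext.zero_comp]

end

section

/-! ### Change of rings -/

open homBimodule

variable {k : Type u} [Field k] {A B : Type v} [Ring A] [Algebra k A] [Ring B] [Algebra k B]

/-- For a homological epimorphism, `B` is acyclic over `A` with respect to `B`-modules: by fullness
`Ext_A(B, N)` is a quotient of `Ext_B(B, N)`. -/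
theorem IsHomologicalEpi.subsingleton_ext {φ : A →+* B} (h : IsHomologicalEpi φ)
    (N : ModuleCat.{v} B) (p : ℕ) :
    Subsingleton (Ext.{v} ((ModuleCat.restrictScalars.{v} φ).obj (ModuleCat.of B B))
      ((ModuleCat.restrictScalars.{v} φ).obj N) (p + 1)) := by
  have : Projective (ModuleCat.of B B) := (IsProjective.iff_projective B).1 inferInstance
  have := Ext.subsingleton_of_projective (ModuleCat.of B B) N p
  let := HasDerivedCategory.standard (ModuleCat.{v} A)
  let := HasDerivedCategory.standard (ModuleCat.{v} B)
  exact (mapExactFunctor_surjective_of_full _ h.1 (ModuleCat.of B B) N (p + 1)).subsingleton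

theorem subsingleton_ext_of_iso {C : Type*} [Category C] [Abelian C] [HasExt C] (X : C) {M N : C}
    (e : M ≅ N) (p : ℕ) [Subsingleton (Ext X N p)] : Subsingleton (Ext X M p) := by
  refine subsingleton_of_forall_eq 0 fun x => ?_
  rw [← x.comp_mk₀_id, ← e.hom_inv_id, ← Ext.mk₀_comp_mk₀,
    ← Ext.comp_assoc _ _ _ (add_zero p) (add_zero 0) (by omega),
    Subsingleton.elim (x.comp (Ext.mk₀ e.hom) (add_zero p)) 0, Ext.zero_comp]

variable (φ : A →ₐ[k] B)

theorem envMap_tmul (a : A) (b : Aᵐᵒᵖ) :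
    (envMap φ).toRingHom (a ⊗ₜ[k] b) = φ a ⊗ₜ[k] MulOpposite.op (φ b.unop) := rfl

/-- Formation of the bimodule `Hom_k(X, Y)` commutes with restriction along `φ`. -/
def restrictHomBimodule (X Y : ModuleCat.{v} B) :
    (restrictBimodule φ).obj (homBimodule k X Y) ≅
      homBimodule k ((ModuleCat.restrictScalars.{v} (φ : A →+* B)).obj X)
        ((ModuleCat.restrictScalars.{v} (φ : A →+* B)).obj Y) where
  hom := envHom
    { toFun f := homBimodule.mk (X := (ModuleCat.restrictScalars.{v} (φ : A →+* B)).obj X)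
        (Y := (ModuleCat.restrictScalars.{v} (φ : A →+* B)).obj Y)
        (toLinearMap (X := X) (Y := Y) f).toAddMonoidHom fun t x => by
          have : φ (algebraMap k A t) = algebraMap k B t := φ.commutes t
          refine (congrArg (fun b : B => toLinearMap (X := X) (Y := Y) f (b • x)) this).trans ?_
          refine ((toLinearMap (X := X) (Y := Y) f).map_smul t (show X from x)).trans ?_
          exact congrArg (fun b : B => b • (toLinearMap (X := X) (Y := Y) f x : Y)) this.symm
      map_zero' := rfl
      map_add' _ _ := rfl }
    fun _ _ _ => rfl
  inv := envHom
    { toFun f := homBimodule.mk (X := X) (Y := Y) (toLinearMap f).toAddMonoidHom fun t x => by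
          have : φ (algebraMap k A t) = algebraMap k B t := φ.commutes t
          refine (congrArg (fun b : B => toLinearMap f (b • x : X)) this.symm).trans ?_
          refine ((toLinearMap f).map_smul t
            (show (ModuleCat.restrictScalars.{v} (φ : A →+* B)).obj X from x)).trans ?_
          exact congrArg (fun b : B => b • (toLinearMap f x : Y)) this
      map_zero' := rfl
      map_add' _ _ := rfl }
    fun _ _ _ => rfl

variable (k B) in
/-- The embedding `n ↦ (b ↦ n * b)` of a bimodule `N` in `Hom_k(B, N)`. -/
def toCoinduced (N : ModuleCat.{v} (Env k B)) :
    N ⟶ homBimodule k (ModuleCat.of B B) ((leftModule k B).obj N) :=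
  envHom
    { toFun n := homBimodule.mk (X := ModuleCat.of B B)
        (coordinateMap (LinearMap.id : (leftModule k B).obj N →ₗ[B] (leftModule k B).obj N)
          n).toAddMonoidHom fun t c =>
            (congrArg (coordinateMap LinearMap.id n) (algebraMap_smul B t (show B from c))).trans
              ((map_smul (coordinateMap LinearMap.id n) t (show B from c)).trans
                (algebraMap_smul B t _).symm)
      map_zero' := homBimodule_ext fun c =>
        coordinateMap_zero (Y := (leftModule k B).obj N) LinearMap.id (show B from c)
      map_add' m n := homBimodule_ext fun c =>
        coordinateMap_add (Y := (leftModule k B).obj N) LinearMap.id m n (show B from c) }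
    fun a b n => homBimodule_ext fun c => 
      coordinateMap_tmul_smul (Y := (leftModule k B).obj N) LinearMap.id a b n (show B from c)

instance (N : ModuleCat.{v} (Env k B)) : Mono (toCoinduced k B N) :=
  (ModuleCat.mono_iff_injective _).2 fun n m h =>
    (one_smul (Env k B) n).symm.trans ((congrArg (fun f => toLinearMap f (1 : B)) h).trans
      (one_smul (Env k B) m))

/-- The comparison in degree `0`. Both sides are central elements of `N`: an element which commutes
with the action of `A` commutes with that of `B`, because `φ` is surjective. -/
theorem bijective_comp_restrict (hφ : Function.Surjective φ) (N : ModuleCat.{v} (Env k B)) :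
    Function.Bijective fun f : regularBimodule k B ⟶ N =>
      bimoduleMap φ ≫ (restrictBimodule φ).map f := by
  constructor
  · intro f g h
    refine regularBimodule_hom_ext ?_
    have : f (φ 1) = g (φ 1) := congrArg (fun f => f.hom (1 : A)) h
    rwa [map_one] at this
  · intro h
    let n : N := h (1 : A)
    have hn (b : B) : (1 ⊗ₜ[k] MulOpposite.op b : Env k B) • n =
        (b ⊗ₜ[k] (1 : Bᵐᵒᵖ) : Env k B) • n := by
      obtain ⟨a, rfl⟩ := hφ b
      have h₁ : (envMap φ).toRingHom (1 ⊗ₜ[k] MulOpposite.op a) = 1 ⊗ₜ[k] MulOpposite.op (φ a) := by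
        rw [envMap_tmul, map_one, MulOpposite.unop_op]
      have h₂ : (envMap φ).toRingHom (a ⊗ₜ[k] 1) = φ a ⊗ₜ[k] 1 := by
        rw [envMap_tmul, MulOpposite.unop_one, map_one, MulOpposite.op_one]
      exact (congrArg (· • n) h₁).symm.trans (((regularBimodule_hom_apply' h a).symm.trans
        (regularBimodule_hom_apply h a)).trans (congrArg (· • n) h₂))
    refine ⟨homOfCentralElement n hn, regularBimodule_hom_ext ?_⟩
    exact (congrArg (homOfCentralElement n hn) (map_one φ)).trans (homOfCentralElement_one n hn)

theorem changeOfRings_bijective (hφ : Function.Surjective φ)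
    (hepi : IsHomologicalEpi (φ : A →+* B)) (p : ℕ) : Function.Bijective (changeOfRings φ p) := by
  refine bijective_comp_mapExactFunctor (F := restrictBimodule φ) (bimoduleMap φ)
    (bijective_comp_restrict φ hφ) (fun N => ⟨_, toCoinduced k B N, inferInstance,
      fun p => ?_, fun p => ?_⟩) p (regularBimodule k B)
  · have : Projective (ModuleCat.of B B) := (IsProjective.iff_projective B).1 inferInstance
    exact subsingleton_ext_homBimodule p _ _ (Ext.subsingleton_of_projective _ _ p)
  · have := subsingleton_ext_homBimodule (k := k) p _ _
      (hepi.subsingleton_ext ((leftModule k B).obj N) p)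
    exact subsingleton_ext_of_iso _ (restrictHomBimodule φ _ _) _

end

section

/-! ### The long exact sequence and the product -/

variable {k : Type u} [Field k] {A B : Type v} [Ring A] [Algebra k A] [Ring B] [Algebra k B]
  (φ : A →ₐ[k] B)

/-- The lift along `changeOfRings` of the image of the unit is the unit. -/
theorem targetMap_one : targetMap φ 0 HH.one = changeOfRings φ 0 HH.one := by
  refine (Ext.mk₀_comp_mk₀ _ _).trans (Eq.trans ?_ (congrArg
    (fun x => (Ext.mk₀ (bimoduleMap φ)).comp x (zero_add 0))
    (Ext.mapExactFunctor_mk₀ (restrictBimodule φ) (𝟙 (regularBimodule k B)))).symm)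
  rw [Category.id_comp, CategoryTheory.Functor.map_id]
  exact (Ext.comp_mk₀_id _).symm

/-- Lifts along `changeOfRings` multiply: `φ` followed by (the restrictions of) `b'` and `b` equals
`a'` followed by `φ` and `b`, and then `a'` followed by `a` and `φ`. -/
theorem changeOfRings_mul {p q : ℕ} {a : HH k A p} {a' : HH k A q} {b : HH k B p} {b' : HH k B q}
    (h : changeOfRings φ p b = targetMap φ p a) (h' : changeOfRings φ q b' = targetMap φ q a') :
    changeOfRings φ (p + q) (HH.mul b b') = targetMap φ (p + q) (HH.mul a a') := by
  have h₀ : (Ext.mk₀ (bimoduleMap φ)).comp (Ext.mapExactFunctor (restrictBimodule φ) b)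
      (zero_add p) = Ext.comp (X := regularBimodule k A) (Y := regularBimodule k A) a
        (Ext.mk₀ (bimoduleMap φ)) (add_zero p) := h
  have h₀' : (Ext.mk₀ (bimoduleMap φ)).comp (Ext.mapExactFunctor (restrictBimodule φ) b')
      (zero_add q) = Ext.comp (X := regularBimodule k A) (Y := regularBimodule k A) a'
        (Ext.mk₀ (bimoduleMap φ)) (add_zero q) := h'
  calc
    _ = (Ext.mk₀ (bimoduleMap φ)).comp ((Ext.mapExactFunctor (restrictBimodule φ) b').comp
          (Ext.mapExactFunctor (restrictBimodule φ) b) (add_comm q p)) (zero_add (p + q)) :=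
      congrArg (fun x => (Ext.mk₀ (bimoduleMap φ)).comp x (zero_add (p + q)))
        (Ext.mapExactFunctor_comp (restrictBimodule φ) b' b (add_comm q p))
    _ = (Ext.comp (X := regularBimodule k A) (Y := regularBimodule k A) a'
          (Ext.mk₀ (bimoduleMap φ)) (add_zero q)).comp
          (Ext.mapExactFunctor (restrictBimodule φ) b) (add_comm q p) := by
      rw [← h₀', Ext.comp_assoc _ _ _ (zero_add q) (add_comm q p) (by omega)]
    _ = Ext.comp (X := regularBimodule k A) (Y := regularBimodule k A) a'
          (Ext.comp (X := regularBimodule k A) (Y := regularBimodule k A) a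
            (Ext.mk₀ (bimoduleMap φ)) (add_zero p)) (add_comm q p) := by
      rw [← h₀]
      exact Ext.comp_assoc _ _ _ (add_zero q) (zero_add p) (by omega)
    _ = _ := (Ext.comp_assoc _ _ _ (add_comm q p) (add_zero p) (by omega)).symm

/-- Linear maps in each degree that respect the unit and the Yoneda product assemble to a morphism
of algebras. -/
theorem exists_algHom_of_mul (g : ∀ p : ℕ, HH k A p →ₗ[k] HH k B p) (hone : g 0 HH.one = HH.one)
    (hmul : ∀ {p q : ℕ} (a : HH k A p) (a' : HH k A q),
      g (p + q) (HH.mul a a') = HH.mul (g p a) (g q a')) :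
    ∃ G : (⨁ p, HH k A p) →ₐ[k] (⨁ p, HH k B p),
      ∀ (p : ℕ) (a : HH k A p),
        G (DirectSum.of (HH k A) p a) = DirectSum.of (HH k B) p (g p a) := by
  refine ⟨DirectSum.toAlgebra k (HH k A) (fun p => DirectSum.lof k ℕ (HH k B) p ∘ₗ g p) ?_ ?_, ?_⟩
  · exact congrArg (DirectSum.of (HH k B) 0) hone
  · intro p q a a'
    change DirectSum.of (HH k B) (p + q) (g (p + q) (HH.mul a a')) =
      DirectSum.of (HH k B) p (g p a) * DirectSum.of (HH k B) q (g q a')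
    rw [hmul, DirectSum.of_mul_of]
    rfl
  · intro p a
    exact DirectSum.toAddMonoid_of
      (fun p => (DirectSum.lof k ℕ (HH k B) p ∘ₗ g p).toAddMonoidHom) p a

theorem inclusionMap_zero_injective : Function.Injective (inclusionMap φ 0) :=
  have : Mono (kerInclusion φ) :=
    (ModuleCat.mono_iff_injective (kerInclusion φ)).2 Subtype.val_injective
  Ext.postcomp_mk₀_injective_of_mono (regularBimodule k A) (kerInclusion φ)

theorem exact_inclusionMap_targetMap (hφ : Function.Surjective φ) (p : ℕ) :
    Function.Exact (inclusionMap φ p) (targetMap φ p) := by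
  intro x
  constructor
  · exact Ext.covariant_sequence_exact₂ _ (kerSequence_shortExact φ hφ) x
  · rintro ⟨y, rfl⟩
    refine (Ext.comp_assoc y (Ext.mk₀ (kerInclusion φ)) (Ext.mk₀ (bimoduleMap φ)) (add_zero p)
      (add_zero 0) (by omega)).trans ?_
    rw [Ext.mk₀_comp_mk₀, (kerSequence φ).zero, Ext.mk₀_zero, Ext.comp_zero]

theorem exact_targetMap_connectingMap (hφ : Function.Surjective φ) (p : ℕ) :
    Function.Exact (targetMap φ p) (connectingMap φ hφ p) := by
  intro x
  constructor
  · exact Ext.covariant_sequence_exact₃ _ (kerSequence_shortExact φ hφ) x rfl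
  · rintro ⟨y, rfl⟩
    refine (Ext.comp_assoc y (Ext.mk₀ (bimoduleMap φ)) (kerSequence_shortExact φ hφ).extClass
      (add_zero p) (zero_add 1) (by omega)).trans ?_
    exact (congrArg (fun z => Ext.comp y z rfl)
      (kerSequence_shortExact φ hφ).comp_extClass).trans (Ext.comp_zero _ _ _ _ _)

theorem exact_connectingMap_inclusionMap (hφ : Function.Surjective φ) (p : ℕ) :
    Function.Exact (connectingMap φ hφ p) (inclusionMap φ (p + 1)) := by
  intro x
  constructor
  · exact fun h => Ext.covariant_sequence_exact₁ _ (kerSequence_shortExact φ hφ) x h rfl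
  · rintro ⟨y, rfl⟩
    refine (Ext.comp_assoc y (kerSequence_shortExact φ hφ).extClass (Ext.mk₀ (kerInclusion φ))
      rfl (add_zero 1) (by omega)).trans ?_
    exact (congrArg (fun z => Ext.comp y z rfl)
      (kerSequence_shortExact φ hφ).extClass_comp).trans (Ext.comp_zero _ _ _ _ _)

end

end

end Hochschild

theorem mainTheorem8 {k : Type u} [Field k] {A B : Type v} [Ring A] [Algebra k A]
    [Ring B] [Algebra k B] (φ : A →ₐ[k] B) (hφ : Function.Surjective φ)
    (hepi : IsHomologicalEpi (φ : A →+* B)) :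
    (∀ p : ℕ, Function.Bijective (changeOfRings φ p)) ∧
    ∃ (g : ∀ p : ℕ, HH k A p →ₗ[k] HH k B p)
      (δ : ∀ p : ℕ, HH k B p →ₗ[k] HochschildCohomology k A (kerBimodule φ) (p + 1)),
      (∀ p a, changeOfRings φ p (g p a) = targetMap φ p a) ∧
      (∀ p b, δ p b = connectingMap φ hφ p (changeOfRings φ p b)) ∧
      Function.Injective (inclusionMap φ 0) ∧
      (∀ p : ℕ, Function.Exact (inclusionMap φ p) (g p) ∧ Function.Exact (g p) (δ p) ∧
        Function.Exact (δ p) (inclusionMap φ (p + 1))) ∧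
      ∃ G : (⨁ p, HH k A p) →ₐ[k] (⨁ p, HH k B p),
        ∀ (p : ℕ) (a : HH k A p),
          G (DirectSum.of (HH k A) p a) = DirectSum.of (HH k B) p (g p a) := by
  have hc := changeOfRings_bijective φ hφ hepi
  let c (p : ℕ) := LinearEquiv.ofBijective (changeOfRings φ p) (hc p)
  let g (p : ℕ) : HH k A p →ₗ[k] HH k B p := (c p).symm.toLinearMap ∘ₗ targetMap φ p
  have hg (p : ℕ) (a : HH k A p) : changeOfRings φ p (g p a) = targetMap φ p a :=
    (c p).apply_symm_apply _
  refine ⟨hc, g, fun p => connectingMap φ hφ p ∘ₗ changeOfRings φ p, hg, fun _ _ => rfl,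
    inclusionMap_zero_injective φ, fun p => ⟨fun x => ?_, fun x => ?_, fun x => ?_⟩, ?_⟩
  · rw [← exact_inclusionMap_targetMap φ hφ p x]
    exact (c p).symm.map_eq_zero_iff
  · refine (exact_targetMap_connectingMap φ hφ p (changeOfRings φ p x)).trans
      (exists_congr fun a => ?_)
    rw [← hg, (hc p).1.eq_iff]
  · rw [exact_connectingMap_inclusionMap φ hφ p x]
    exact (hc p).2.exists
  · refine exists_algHom_of_mul g ((hc 0).1 ((hg 0 _).trans (targetMap_one φ))) fun a a' => ?_
    exact (hc _).1 ((hg _ _).trans (changeOfRings_mul φ (hg _ a) (hg _ a')).symm)
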